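/- **Setting.** Let $n\ge 1$ and $N\ge 0$ be integers, $A,d>0$. Points of $\mathbb R^{n+1}$ are $\mathbf x=(x_1,\dots,x_n,y)$; for $1<a<b$ let $\Omega=\Omega_{a,b}=\{-A<x_1,\dots,x_n<A,\ a<y<b\}$. For $\alpha\in[-d,d]$ let $\mathbf x_\alpha=(\alpha,0,\dots,0)$ and $\nu(\mathbf x,\alpha)=(\nu_1,\dots,\nu_{n+1})=(\mathbf x-\mathbf x_\alpha)/|\mathbf x-\mathbf x_\alpha|$. Let $\{\Psi_s\}_{s\ge0}$ be the orthonormal system obtained from $\{\alpha^s e^\alpha\}_{s\ge0}$ by the Gram–Schmidt procedure in $L^2(-d,d)$. Define the $N\times N$ matrices with entries (row $k$, column $s$, $0\le k,s\le N-1$) $$(M_N)_{ks}=\int_{-d}^d\Psi_s'\Psi_k\,d\alpha,\qquad (A_{n+1}(\mathbf x))_{ks}=\int_{-d}^d\frac{\partial_\alpha\nu_{n+1}}{\nu_{n+1}}\Psi_s\Psi_k\,d\alpha,$$ $$(A_i(\mathbf x))_{ks}=\int_{-d}^d\Big(\frac{\nu_i}{\nu_{n+1}}\Psi_s'+\frac{\partial_\alpha\nu_i}{\nu_{n+1}}\Psi_s\Big)\Psi_k\,d\alpha\quad(1\le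 i\le n),\qquad D_N(\mathbf x)=M_N+A_{n+1}(\mathbf x).$$ Let $0\le\mu_s\in C^2(\mathbb R^{n+1})$ vanish outside $\Omega$, and let $0\le K(\mathbf x,\alpha,\beta)\in C^2(\overline\Omega\times[-d,d]^2)$. For $w\in\mathbb R^N$ write $w(\alpha)=\sum_{s=0}^{N-1}w_s\Psi_s(\alpha)$ and define $F(w,\mathbf x)\in\mathbb R^N$ by $$F_k(w,\mathbf x)=-\int_{-d}^d\frac{\mu_s(\mathbf x)}{\nu_{n+1}(\mathbf x,\alpha)}\,\partial_\alpha\Big[e^{-w(\alpha)}\int_{-d}^dK(\mathbf x,\alpha,\beta)e^{w(\beta)}d\beta\Big]\Psi_k(\alpha)\,d\alpha .$$ Let $m>1$ be an integer, $h=2A/m$, and let $\Omega^h$ be the semi-discrete domain of the points $\mathbf x^h=(x_1,\dots,x_n,y)$ with $x_i\in\{-A+jh:\ 0\le j\le m\}$ and $y\in(a,b)$. Its boundary $\partial\Omega^h$ consists of the grid points with $y=a$ or $y=b$ and of the points with $y\in(a,b)$ and some $x_i=\pm A$; a grid point is interior if no $x_i$ equals $\pm A$. At interior grid points $W^h_{x_i}$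 denotes the central difference quotient with step $2h$. The space $H^{1,h}_N$ consists of the $\mathbb R^N$-valued functions $W^h$ on $\overline{\Omega^h}$ which at every interior grid point belong to $H^1(a,b)$ in $y$ (continuous representatives) and whose $W^h_{x_i}$ belong to $L^2(a,b)$ there; $L^{2,h}$ consists of the scalar functions which are in $L^2(a,b)$ in $y$ at every interior grid point (and are identified if they agree there for almost every $y$). For given boundary data $P^h:\partial\Omega^h\to\mathbb R^N$ consider the following conditions on a pair $(W^h,a^h)\in H^{1,h}_N\times L^{2,h}$, where $w^h(\mathbf x^h,\alpha)=\sum_{s}W^h_s(\mathbf x^h)\Psi_s(\alpha)$ and (1), (3) are understood at interior grid points for almost every $y\in(a,b)$: 1. $D_N(\mathbf x^h)W^h_y+\sum_{i=1}^nA_i(\mathbf x^h)W^h_{x_i}+F(W^h(\mathbf x^h),\mathbf x^h)=0$; 2. $W^h|_{\partial\Omega^h}=P^h$; 3. $\displaystyle a^h(\mathbf x^h)=-\frac1{2d}\int_{-d}^d\nu(\mathbf x^h,\alpha)\cdot\nabla_{\mathbf x^h}w^h(\mathbf x^h,\alpha)\,d\alpha+\frac1{2d}\int_{-d}^d e^{-w^h(\mathbf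 x^h,\alpha)}\mu_s(\mathbf x^h)\int_{-d}^dK(\mathbf x^h,\alpha,\beta)e^{w^h(\mathbf x^h,\beta)}\,d\beta\,d\alpha$, with $\nabla_{\mathbf x^h}$ made of the difference quotients in $x_1,\dots,x_n$ and of $\partial_y$. **Theorem 4.3.** There is a number $a_0=a_0(n,A,d,N)>1$ such that $D_N(\mathbf x)$ is invertible for all $\mathbf x\in\overline{\Omega_{a,b}}$ whenever $a_0\le a<b$. Let $a_0$ be any such number and let $a\ge a_0$, $b>a$. Then for all $m,\mu_s,K,P^h$ as above there is at most one pair $(W^h,a^h)\in H^{1,h}_N\times L^{2,h}$ that satisfies the semi-discrete system (1) with the boundary condition (2), together with the reconstruction formula (3). -/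

import Mathlib

open MeasureTheory Set

open scoped Matrix

noncomputable section

namespace RTE

/-! Points of `ℝⁿ⁺¹` are pairs `(x, y)` with `x ∈ ℝⁿ` and `y ∈ ℝ`. -/

/-- The rectangular prism `-A < x₁, …, xₙ < A`, `a < y < b`. -/
def Omega (n : ℕ) (A a b : ℝ) : Set ((Fin n → ℝ) × ℝ) :=
  (Set.univ.pi fun _ => Ioo (-A) A) ×ˢ Ioo a b

/-! ### The direction field of the sources `(α, 0, …, 0)` -/

/-- The `i`-th component of `x - x_α` for `i = 1, …, n`. -/
def shift {n : ℕ} [NeZero n] (x : (Fin n → ℝ) × ℝ) (α : ℝ) (i : Fin n) : ℝ :=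
  x.1 i - if i = 0 then α else 0

/-- The Euclidean distance `|x - x_α|`. -/
def dist0 {n : ℕ} [NeZero n] (x : (Fin n → ℝ) × ℝ) (α : ℝ) : ℝ :=
  Real.sqrt ((∑ i, shift x α i ^ 2) + x.2 ^ 2)

/-- The components `ν₁, …, νₙ` of the unit vector `(x - x_α) / |x - x_α|`. -/
def nu {n : ℕ} [NeZero n] (i : Fin n) (x : (Fin n → ℝ) × ℝ) (α : ℝ) : ℝ :=
  shift x α i / dist0 x α

/-- The last component `νₙ₊₁ = y / |x - x_α|` of the same unit vector. -/
def nuLast {n : ℕ} [NeZero n] (x : (Fin n → ℝ) × ℝ) (α : ℝ) : ℝ :=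
  x.2 / dist0 x α

/-! ### The orthonormal basis of `L²(-d, d)` -/

/-- The scalar product of `L²(-d, d)`. -/
def ip (d : ℝ) (f g : ℝ → ℝ) : ℝ := ∫ α in (-d)..d, f α * g α

/-- Gram–Schmidt orthogonalization of `α ^ s * exp α`, `s = 0, 1, 2, …`, in `L²(-d, d)`. -/
def gs (d : ℝ) (s : ℕ) : ℝ → ℝ := fun α =>
  α ^ s * Real.exp α -
    ∑ k : Fin s, ip d (gs d k) (fun t => t ^ s * Real.exp t) / ip d (gs d k) (gs d k) * gs d k α
termination_by s
decreasing_by all_goals exact k.2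

/-- The orthonormal basis functions `Ψ_s`. -/
def Psi (d : ℝ) (s : ℕ) : ℝ → ℝ := fun α => gs d s α / Real.sqrt (ip d (gs d s) (gs d s))

/-! ### The matrices and the nonlinearity of the projected system

Row `k`, column `s`: the coefficient of (the derivative of) `w_s` in the equation that results from
multiplication by `Ψ_k` and integration over `(-d, d)`. -/

/-- The matrix `M_N`. -/
def matM (N : ℕ) (d : ℝ) : Matrix (Fin N) (Fin N) ℝ :=
  Matrix.of fun k s => ∫ α in (-d)..d, deriv (Psi d s) α * Psi d k α

/-- The matrix `Aₙ₊₁(x)`. -/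
def matALast {n : ℕ} [NeZero n] (N : ℕ) (d : ℝ) (x : (Fin n → ℝ) × ℝ) :
    Matrix (Fin N) (Fin N) ℝ :=
  Matrix.of fun k s => ∫ α in (-d)..d,
    deriv (nuLast x) α / nuLast x α * Psi d s α * Psi d k α

/-- The matrices `Aᵢ(x)`, `i = 1, …, n`. -/
def matA {n : ℕ} [NeZero n] (N : ℕ) (d : ℝ) (i : Fin n) (x : (Fin n → ℝ) × ℝ) :
    Matrix (Fin N) (Fin N) ℝ :=
  Matrix.of fun k s => ∫ α in (-d)..d,
    (nu i x α / nuLast x α * deriv (Psi d s) α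
      + deriv (nu i x) α / nuLast x α * Psi d s α) * Psi d k α

/-- The matrix `D_N(x) = M_N + Aₙ₊₁(x)`. -/
def matD {n : ℕ} [NeZero n] (N : ℕ) (d : ℝ) (x : (Fin n → ℝ) × ℝ) :
    Matrix (Fin N) (Fin N) ℝ :=
  matM N d + matALast N d x

/-- The truncated series `∑ₛ w_s Ψ_s(α)`. -/
def expand {N : ℕ} (d : ℝ) (w : Fin N → ℝ) (α : ℝ) : ℝ := ∑ s, w s * Psi d s α

/-- `exp(-w(α)) ∫ K(x, α, β) exp(w(β)) dβ` with `w = ∑ₛ w_s Ψ_s`. -/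
def scatter {n N : ℕ} (d : ℝ) (K : (Fin n → ℝ) × ℝ → ℝ → ℝ → ℝ) (w : Fin N → ℝ)
    (x : (Fin n → ℝ) × ℝ) (α : ℝ) : ℝ :=
  Real.exp (-expand d w α) * ∫ β in (-d)..d, K x α β * Real.exp (expand d w β)

/-- The nonlinear term `F(w, x)`; `mu` is the scattering coefficient. -/
def nonlin {n N : ℕ} [NeZero n] (d : ℝ) (mu : (Fin n → ℝ) × ℝ → ℝ)
    (K : (Fin n → ℝ) × ℝ → ℝ → ℝ → ℝ) (w : Fin N → ℝ) (x : (Fin n → ℝ) × ℝ) : Fin N → ℝ :=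
  fun k => ∫ α in (-d)..d, -(mu x / nuLast x α * deriv (scatter d K w x) α) * Psi d k α

/-- `a₀ > 1` is such that `D_N(x)` is invertible on the closed prism as soon as its bottom
`y = a` satisfies `a ≥ a₀`. The notion involves `n`, `N`, `A`, `d` only. -/
def IsThreshold (n N : ℕ) [NeZero n] (A d a₀ : ℝ) : Prop :=
  1 < a₀ ∧ ∀ a b : ℝ, a₀ ≤ a → a < b → ∀ x ∈ closure (Omega n A a b), IsUnit (matD N d x)

/-! ### The semi-discrete domain

Grid points are indexed by `J = (j₁, …, jₙ)` with `0 ≤ jᵢ ≤ m`. A semi-discrete function is a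
family `J ↦ (y ↦ W J y)`; only its values on the grid and for `y ∈ [a, b]` matter. -/

/-- `J` indexes a grid point. -/
def OnGrid {n : ℕ} (m : ℕ) (J : Fin n → ℕ) : Prop := ∀ i, J i ≤ m

/-- `J` indexes an interior grid point. -/
def Interior {n : ℕ} (m : ℕ) (J : Fin n → ℕ) : Prop := ∀ i, 0 < J i ∧ J i < m

/-- The step size of the uniform partition of `[-A, A]` into `m` intervals. -/
def step (A : ℝ) (m : ℕ) : ℝ := 2 * A / m

/-- The point of the semi-discrete domain with grid index `J` and last coordinate `y`. -/
def pt {n : ℕ} (A : ℝ) (m : ℕ) (J : Fin n → ℕ) (y : ℝ) : (Fin n → ℝ) × ℝ :=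
  (fun i => -A + J i * step A m, y)

/-- `(J, y)` lies on the boundary of the semi-discrete domain: bottom, top, or lateral part. -/
def OnBoundary {n : ℕ} (a b : ℝ) (m : ℕ) (J : Fin n → ℕ) (y : ℝ) : Prop :=
  OnGrid m J ∧ (y = a ∨ y = b ∨ ((∃ i, J i = 0 ∨ J i = m) ∧ y ∈ Ioo a b))

/-- The central difference quotient in the direction `xᵢ` (used at interior grid points only). -/
def fdiff {n N : ℕ} (A : ℝ) (m : ℕ) (W : (Fin n → ℕ) → ℝ → Fin N → ℝ) (i : Fin n)
    (J : Fin n → ℕ) (y : ℝ) : Fin N → ℝ :=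
  fun s => (W (Function.update J i (J i + 1)) y s - W (Function.update J i (J i - 1)) y s)
    / (2 * step A m)

/-- The derivative in `y`. -/
def dy {n N : ℕ} (W : (Fin n → ℕ) → ℝ → Fin N → ℝ) (J : Fin n → ℕ) (y : ℝ) : Fin N → ℝ :=
  fun s => deriv (fun t => W J t s) y

/-- Square integrability on `(a, b)`. -/
def IsL2 (a b : ℝ) (f : ℝ → ℝ) : Prop := MemLp f 2 (volume.restrict (Ioo a b))

/-- The Sobolev space `H¹(a, b)` through continuous representatives: absolutely continuous on
`[a, b]` with square integrable derivative. -/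
def IsH1 (a b : ℝ) (f : ℝ → ℝ) : Prop :=
  AbsolutelyContinuousOnInterval f a b ∧ IsL2 a b (deriv f)

/-- Membership in `H^{1,h}_N`: at interior grid points every component is in `H¹(a, b)`, and so
square integrable, and all the difference quotients are square integrable. -/
def MemH1h {n N : ℕ} (A a b : ℝ) (m : ℕ) (W : (Fin n → ℕ) → ℝ → Fin N → ℝ) : Prop :=
  ∀ J, Interior m J → ∀ s,
    IsH1 a b (fun y => W J y s) ∧ ∀ i, IsL2 a b (fun y => fdiff A m W i J y s)

/-- Membership of a scalar function in `L^{2,h}`. -/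
def MemL2h {n : ℕ} (a b : ℝ) (m : ℕ) (c : (Fin n → ℕ) → ℝ → ℝ) : Prop :=
  ∀ J, Interior m J → IsL2 a b (c J)

/-! ### The semi-discrete problem -/

/-- The semi-discrete system `D_N W_y + ∑ᵢ Aᵢ W_{xᵢ} + F(W, x) = 0`. -/
def SolvesSystem {n N : ℕ} [NeZero n] (A a b d : ℝ) (m : ℕ) (mu : (Fin n → ℝ) × ℝ → ℝ)
    (K : (Fin n → ℝ) × ℝ → ℝ → ℝ → ℝ) (W : (Fin n → ℕ) → ℝ → Fin N → ℝ) : Prop :=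
  ∀ J, Interior m J → ∀ᵐ y ∂(volume.restrict (Ioo a b)),
    matD N d (pt A m J y) *ᵥ dy W J y
      + ∑ i, matA N d i (pt A m J y) *ᵥ fdiff A m W i J y
      + nonlin d mu K (W J y) (pt A m J y) = 0

/-- The boundary condition `W = P` on the boundary of the semi-discrete domain. -/
def HasBoundaryValues {n N : ℕ} (a b : ℝ) (m : ℕ) (P W : (Fin n → ℕ) → ℝ → Fin N → ℝ) : Prop :=
  ∀ J y, OnBoundary a b m J y → W J y = P J y

/-- `ν · ∇w` at the point with index `(J, y)`, where `w = ∑ₛ W_s Ψ_s`. -/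
def transport {n N : ℕ} [NeZero n] (A d : ℝ) (m : ℕ) (W : (Fin n → ℕ) → ℝ → Fin N → ℝ)
    (J : Fin n → ℕ) (y α : ℝ) : ℝ :=
  (∑ i, nu i (pt A m J y) α * expand d (fdiff A m W i J y) α)
    + nuLast (pt A m J y) α * expand d (dy W J y) α

/-- The reconstruction formula for the coefficient `c = a^h`. -/
def Reconstructs {n N : ℕ} [NeZero n] (A a b d : ℝ) (m : ℕ) (mu : (Fin n → ℝ) × ℝ → ℝ)
    (K : (Fin n → ℝ) × ℝ → ℝ → ℝ → ℝ) (W : (Fin n → ℕ) → ℝ → Fin N → ℝ)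
    (c : (Fin n → ℕ) → ℝ → ℝ) : Prop :=
  ∀ J, Interior m J → ∀ᵐ y ∂(volume.restrict (Ioo a b)),
    c J y = -(1 / (2 * d)) * (∫ α in (-d)..d, transport A d m W J y α)
      + 1 / (2 * d) * ∫ α in (-d)..d, Real.exp (-expand d (W J y) α) * mu (pt A m J y)
          * ∫ β in (-d)..d, K (pt A m J y) α β * Real.exp (expand d (W J y) β)

/-- `(W, c) ∈ H^{1,h}_N × L^{2,h}` solves the semi-discrete boundary value problem with boundary
data `P`, and `c` is the coefficient reconstructed from `W`. -/
structure IsSolution {n N : ℕ} [NeZero n] (A a b d : ℝ) (m : ℕ) (mu : (Fin n → ℝ) × ℝ → ℝ)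
    (K : (Fin n → ℝ) × ℝ → ℝ → ℝ → ℝ) (P W : (Fin n → ℕ) → ℝ → Fin N → ℝ)
    (c : (Fin n → ℕ) → ℝ → ℝ) : Prop where
  memH1 : MemH1h A a b m W
  memL2 : MemL2h a b m c
  system : SolvesSystem A a b d m mu K W
  boundary : HasBoundaryValues a b m P W
  reconstruction : Reconstructs A a b d m mu K W c

end RTE

end

/-!
Existence of a threshold: `Ψ_s(α) = p_s(α) exp α` with `deg p_s = s`, so `Ψ_s' - Ψ_s` lies in the
span of `Ψ_0, …, Ψ_{s-1}`. Hence `M_N` is upper triangular with unit diagonal and `det M_N = 1`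
(`det_matM`). The entries of `Aₙ₊₁(x)` are `O(y⁻²)` on the prism (`abs_matALast_le`), and
invertibility is an open condition, so `D_N(x) = M_N + Aₙ₊₁(x)` is invertible for large `y`
(`exists_isThreshold`).

Uniqueness: after multiplication by `D_N⁻¹`, the semi-discrete system is a finite system of ordinary
differential equations in `y` for the values at the interior grid points, with initial values
prescribed at `y = a`; the neighbours on the lateral boundary carry prescribed values as well. On
the compact closed prism `D_N⁻¹` and the `Aᵢ` are bounded (`exists_bound_inv_matD`, `abs_matA_le`),
the step of the grid is fixed, and the nonlinearity is Lipschitz continuous on bounded sets of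
coefficients, uniformly in `x` (`exists_lipschitz_nonlin`). The last fact rests on differentiation
under the integral sign in `∫ K(x, α, β) exp(w(β)) dβ`. Since functions in `H¹(a, b)` are
continuous, two solutions have a common bound, and their difference `V` satisfies `|V_y| ≤ C ∑ |V|`
almost everywhere and `V = 0` at `y = a`. Grönwall's inequality for absolutely continuous functions
(`eq_zero_of_ae_abs_deriv_le`) gives `V = 0`. The coefficient is then determined by the
reconstruction formula (`ae_eq_of_reconstructs`).
-/

noncomputable section

namespace RTE

/-! ### The Gram–Schmidt system and the matrix `M_N` -/

/-- The functions `gs d s` are `p(α) exp α` with `p` monic of degree `s`. -/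
lemma exists_gs_eq_poly_mul_exp (d : ℝ) (s : ℕ) :
    ∃ p : Polynomial ℝ, p.Monic ∧ p.natDegree = s ∧
      gs d s = fun α => p.eval α * Real.exp α := by
  induction s using Nat.strong_induction_on with
  | _ s ih =>
    choose p hp using ih
    set q : Polynomial ℝ := ∑ k : Fin s, Polynomial.C
      (ip d (gs d k) (fun t => t ^ s * Real.exp t) / ip d (gs d k) (gs d k)) * p k k.2 with hq
    have hdeg : q.degree < (s : WithBot ℕ) := by
      rw [← Polynomial.mem_degreeLT]
      refine Submodule.sum_mem _ fun k _ => Polynomial.mem_degreeLT.2 ?_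
      rw [← Polynomial.smul_eq_C_mul]
      refine (Polynomial.degree_smul_le _ _).trans_lt ?_
      rw [Polynomial.degree_eq_natDegree (hp k k.2).1.ne_zero, (hp k k.2).2.1]
      exact_mod_cast k.2
    refine ⟨Polynomial.X ^ s - q, Polynomial.monic_X_pow_sub hdeg, ?_, ?_⟩
    · refine Polynomial.natDegree_eq_of_degree_eq_some ?_
      rw [Polynomial.degree_sub_eq_left_of_degree_lt] <;> simp [hdeg]
    · funext α
      rw [gs]
      simp only [Polynomial.eval_sub, Polynomial.eval_pow, Polynomial.eval_X, sub_mul, hq,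
        Polynomial.eval_finsetSum, Polynomial.eval_mul, Polynomial.eval_C, Finset.sum_mul]
      congr 1
      refine Finset.sum_congr rfl fun k _ => ?_
      rw [show gs d k α = _ from congrFun (hp k k.2).2.2 α]
      ring

lemma contDiff_gs (d : ℝ) (s : ℕ) : ContDiff ℝ 2 (gs d s) := by
  obtain ⟨p, -, -, hp⟩ := exists_gs_eq_poly_mul_exp d s
  rw [hp]
  exact (by simpa using p.contDiff_aeval (𝕜 := ℝ) 2 : ContDiff ℝ 2 fun α => p.eval α).mul
    Real.contDiff_exp

lemma ip_comm (d : ℝ) (f g : ℝ → ℝ) : ip d f g = ip d g f := by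
  simp only [ip, mul_comm]

lemma ip_gs_self_pos {d : ℝ} (hd : 0 < d) (s : ℕ) : 0 < ip d (gs d s) (gs d s) := by
  obtain ⟨p, hm, -, hp⟩ := exists_gs_eq_poly_mul_exp d s
  obtain ⟨c, hc, hcr⟩ : ∃ c ∈ Icc (-d) d, ¬ p.IsRoot c := by
    by_contra! h
    exact (Icc_infinite (by linarith : -d < d)) (((p.roots.toFinset).finite_toSet).subset
      fun x hx => by simpa [hm.ne_zero] using h x hx)
  refine intervalIntegral.integral_pos (by linarith) ?_ (fun x _ => mul_self_nonneg _)
    ⟨c, hc, mul_self_pos.2 ?_⟩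
  · have := (contDiff_gs d s).continuous
    fun_prop
  · rw [hp]
    exact mul_ne_zero hcr (Real.exp_pos _).ne'

lemma ip_gs_gs_of_lt {d : ℝ} (hd : 0 < d) (k : ℕ) : ∀ j < k, ip d (gs d j) (gs d k) = 0 := by
  induction k using Nat.strong_induction_on with
  | _ k ih =>
    intro j hj
    have hc := fun s => (contDiff_gs d s).continuous
    have hcj := hc j
    have horth : ∀ i : Fin k, (i : ℕ) ≠ j → ip d (gs d j) (gs d i) = 0 := by
      intro i hij
      rcases lt_or_gt_of_ne hij with h | h
      · rw [ip_comm]; exact ih j hj i h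
      · exact ih i i.2 j h
    have hexp : ip d (gs d j) (gs d k) = ip d (gs d j) (fun t => t ^ k * Real.exp t)
        - ∑ i : Fin k, ip d (gs d i) (fun t => t ^ k * Real.exp t) / ip d (gs d i) (gs d i)
            * ip d (gs d j) (gs d i) := by
      conv_lhs => rw [ip]
      simp only [gs.eq_def d k, mul_sub, Finset.mul_sum]
      rw [intervalIntegral.integral_sub, intervalIntegral.integral_finsetSum]
      · congr 1
        refine Finset.sum_congr rfl fun i _ => ?_
        rw [ip, ip, ip, ← intervalIntegral.integral_const_mul]
        refine intervalIntegral.integral_congr fun x _ => ?_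
        ring
      · intro i _
        have := hc i
        exact Continuous.intervalIntegrable (by fun_prop) _ _
      · exact Continuous.intervalIntegrable (by fun_prop) _ _
      · refine Continuous.intervalIntegrable (continuous_finsetSum _ fun i _ => ?_) _ _
        have := hc i
        fun_prop
    rw [hexp, Finset.sum_eq_single ⟨j, hj⟩]
    · rw [div_mul_cancel₀ _ (ip_gs_self_pos hd j).ne', sub_self]
    · intro i _ hi
      rw [horth i (fun h => hi (Fin.ext h)), mul_zero]
    · simp

/-- `gs d k` is orthogonal to `q(α) exp α` for every polynomial `q` of degree less than `k`,
because these functions are spanned by `gs d 0, …, gs d (k - 1)`. -/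
lemma ip_poly_mul_exp_gs {d : ℝ} (hd : 0 < d) (k : ℕ) : ∀ (r : ℕ) (q : Polynomial ℝ),
    r ≤ k → q.degree < (r : WithBot ℕ) → ip d (fun α => q.eval α * Real.exp α) (gs d k) = 0 := by
  intro r
  induction r with
  | zero =>
    intro q _ hq
    have : q = 0 := by
      rw [← Polynomial.degree_eq_bot]
      simpa using hq
    simp [this, ip]
  | succ r ih =>
    intro q hr hq
    obtain ⟨p, hm, hdeg, hp⟩ := exists_gs_eq_poly_mul_exp d r
    have hlow : (q - Polynomial.C (q.coeff r) * p).degree < (r : WithBot ℕ) := by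
      rw [Polynomial.degree_lt_iff_coeff_zero] at hq ⊢
      intro j hj
      rcases eq_or_lt_of_le hj with h | h
      · subst h
        have : p.coeff r = 1 := by rw [← hdeg]; exact hm
        simp [this]
      · simp [hq j h, Polynomial.coeff_eq_zero_of_natDegree_lt (hdeg.trans_lt h)]
    have h1 := ih _ (by omega) hlow
    have h2 := ip_gs_gs_of_lt hd k r (by omega)
    have hck := (contDiff_gs d k).continuous
    have hcr := (contDiff_gs d r).continuous
    have hsum : ip d (fun α => q.eval α * Real.exp α) (gs d k)
        = ip d (fun α => (q - Polynomial.C (q.coeff r) * p).eval α * Real.exp α) (gs d k)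
          + q.coeff r * ip d (gs d r) (gs d k) := by
      rw [ip, ip, ip, ← intervalIntegral.integral_const_mul, ← intervalIntegral.integral_add]
      · refine intervalIntegral.integral_congr fun x _ => ?_
        simp only [Polynomial.eval_sub, Polynomial.eval_mul, Polynomial.eval_C, hp]
        ring
      · exact Continuous.intervalIntegrable (by fun_prop) _ _
      · exact Continuous.intervalIntegrable (by fun_prop) _ _
    rw [hsum, h1, h2, mul_zero, add_zero]

lemma contDiff_Psi (d : ℝ) (s : ℕ) : ContDiff ℝ 2 (Psi d s) :=
  (contDiff_gs d s).div_const _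

lemma continuous_Psi (d : ℝ) (s : ℕ) : Continuous (Psi d s) := (contDiff_Psi d s).continuous

lemma differentiable_Psi (d : ℝ) (s : ℕ) : Differentiable ℝ (Psi d s) :=
  (contDiff_Psi d s).differentiable (by norm_num)

lemma continuous_deriv_Psi (d : ℝ) (s : ℕ) : Continuous (deriv (Psi d s)) :=
  (contDiff_Psi d s).continuous_deriv (by norm_num)

lemma integral_Psi_sq {d : ℝ} (hd : 0 < d) (s : ℕ) :
    ∫ α in (-d)..d, Psi d s α * Psi d s α = 1 := by
  have hpos := ip_gs_self_pos hd s
  have : ∀ α, Psi d s α * Psi d s α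
      = (ip d (gs d s) (gs d s))⁻¹ * (gs d s α * gs d s α) := by
    intro α
    simp only [Psi]
    rw [div_mul_div_comm, Real.mul_self_sqrt hpos.le, div_eq_inv_mul]
  simp only [this]
  rw [intervalIntegral.integral_const_mul]
  exact inv_mul_cancel₀ hpos.ne'

/-- `Ψ_s' - Ψ_s` is, up to a factor, `p'(α) exp α` with `p` of degree `s`. -/
lemma exists_deriv_Psi_eq (d : ℝ) (s : ℕ) : ∃ q : Polynomial ℝ, q.degree < (s : WithBot ℕ) ∧
    ∀ α, deriv (Psi d s) α = Psi d s α + q.eval α * Real.exp α := by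
  obtain ⟨p, hm, hdeg, hp⟩ := exists_gs_eq_poly_mul_exp d s
  refine ⟨Polynomial.C (Real.sqrt (ip d (gs d s) (gs d s)))⁻¹ * p.derivative, ?_, ?_⟩
  · rw [← Polynomial.smul_eq_C_mul]
    refine (Polynomial.degree_smul_le _ _).trans_lt ?_
    rw [← hdeg, ← Polynomial.degree_eq_natDegree hm.ne_zero]
    exact Polynomial.degree_derivative_lt hm.ne_zero
  · intro α
    have h : HasDerivAt (gs d s)
        (p.derivative.eval α * Real.exp α + p.eval α * Real.exp α) α := by
      rw [hp]
      exact (p.hasDerivAt α).mul (Real.hasDerivAt_exp α)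
    have h' : HasDerivAt (Psi d s) _ α := h.div_const (Real.sqrt (ip d (gs d s) (gs d s)))
    rw [h'.deriv]
    simp only [Psi, Polynomial.eval_mul, Polynomial.eval_C, show gs d s α = _ from congrFun hp α]
    ring

lemma integral_poly_mul_exp_mul_Psi {d : ℝ} (hd : 0 < d) {k : ℕ} {q : Polynomial ℝ}
    (hq : q.degree < (k : WithBot ℕ)) :
    ∫ α in (-d)..d, (q.eval α * Real.exp α) * Psi d k α = 0 := by
  simp only [Psi, ← mul_div_assoc]
  rw [intervalIntegral.integral_div, div_eq_zero_iff]
  exact Or.inl (ip_poly_mul_exp_gs hd k k q le_rfl hq)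

lemma det_matM (N : ℕ) {d : ℝ} (hd : 0 < d) : (matM N d).det = 1 := by
  rw [Matrix.det_of_isUpperTriangular]
  · refine Finset.prod_eq_one fun s _ => ?_
    obtain ⟨q, hq, hder⟩ := exists_deriv_Psi_eq d s
    have hc := continuous_Psi d s
    simp only [matM, Matrix.of_apply, hder, add_mul]
    rw [intervalIntegral.integral_add, integral_Psi_sq hd, integral_poly_mul_exp_mul_Psi hd hq,
      add_zero]
    · exact Continuous.intervalIntegrable (by fun_prop) _ _
    · exact Continuous.intervalIntegrable (by fun_prop) _ _
  · intro k s hsk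
    have hsk : (s : ℕ) < k := hsk
    obtain ⟨p, hm, hdeg, hp⟩ := exists_gs_eq_poly_mul_exp d s
    obtain ⟨q, hq, hder⟩ := exists_deriv_Psi_eq d s
    have : ∀ α, deriv (Psi d s) α
        = (Polynomial.C (Real.sqrt (ip d (gs d s) (gs d s)))⁻¹ * p + q).eval α * Real.exp α := by
      intro α
      rw [hder]
      simp only [Psi, Polynomial.eval_add, Polynomial.eval_mul, Polynomial.eval_C, hp]
      ring
    simp only [matM, Matrix.of_apply, this]
    refine integral_poly_mul_exp_mul_Psi hd ?_
    have hsk' : (s : WithBot ℕ) < (k : WithBot ℕ) := by exact_mod_cast hsk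
    refine (Polynomial.degree_add_le _ _).trans_lt (max_lt ?_ (hq.trans hsk'))
    rw [← Polynomial.smul_eq_C_mul]
    refine (Polynomial.degree_smul_le _ _).trans_lt ?_
    rwa [Polynomial.degree_eq_natDegree hm.ne_zero, hdeg]

/-! ### The direction field -/

section DirectionField

variable {n : ℕ} [NeZero n] {x : (Fin n → ℝ) × ℝ}

lemma dist0_sq_pos (hx : 0 < x.2) (α : ℝ) : 0 < (∑ i, shift x α i ^ 2) + x.2 ^ 2 :=
  add_pos_of_nonneg_of_pos (Finset.sum_nonneg fun _ _ => sq_nonneg _) (pow_pos hx 2)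

lemma dist0_pos (hx : 0 < x.2) (α : ℝ) : 0 < dist0 x α := Real.sqrt_pos.2 (dist0_sq_pos hx α)

lemma sq_dist0 (hx : 0 < x.2) (α : ℝ) : dist0 x α ^ 2 = (∑ i, shift x α i ^ 2) + x.2 ^ 2 :=
  Real.sq_sqrt (dist0_sq_pos hx α).le

lemma le_dist0 (x : (Fin n → ℝ) × ℝ) (α : ℝ) : x.2 ≤ dist0 x α :=
  Real.le_sqrt_of_sq_le (le_add_of_nonneg_left (Finset.sum_nonneg fun _ _ => sq_nonneg _))

lemma hasDerivAt_shift (α : ℝ) (i : Fin n) :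
    HasDerivAt (fun t => shift x t i) (-if i = 0 then 1 else 0) α := by
  unfold shift
  by_cases h : i = 0
  · simpa [h] using (hasDerivAt_id α).const_sub (x.1 0)
  · simpa [h] using hasDerivAt_const α (x.1 i)

lemma hasDerivAt_dist0 (hx : 0 < x.2) (α : ℝ) :
    HasDerivAt (dist0 x) (-shift x α 0 / dist0 x α) α := by
  have h1 : HasDerivAt (fun t => (∑ i, shift x t i ^ 2) + x.2 ^ 2) (-2 * shift x α 0) α := by
    have := (HasDerivAt.fun_sum (u := Finset.univ)
      fun i _ => (hasDerivAt_shift (x := x) α i).fun_pow 2).add_const (x.2 ^ 2)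
    refine this.congr_deriv ?_
    rw [Finset.sum_eq_single 0]
    · simp
    · intro i _ hi
      simp [hi]
    · simp
  refine (h1.sqrt (dist0_sq_pos hx α).ne').congr_deriv ?_
  rw [show Real.sqrt _ = dist0 x α from rfl]
  have := (dist0_pos hx α).ne'
  field_simp

lemma continuous_dist0 (hx : 0 < x.2) : Continuous (dist0 x) :=
  continuous_iff_continuousAt.2 fun α => (hasDerivAt_dist0 hx α).continuousAt

lemma deriv_nuLast_div (hx : 0 < x.2) (α : ℝ) :
    deriv (nuLast x) α / nuLast x α = shift x α 0 / ((∑ i, shift x α i ^ 2) + x.2 ^ 2) := by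
  have hd := (dist0_pos hx α).ne'
  have h : HasDerivAt (nuLast x) _ α :=
    (hasDerivAt_const α x.2).div (hasDerivAt_dist0 hx α) hd
  rw [h.deriv, ← sq_dist0 hx, nuLast]
  have := hx.ne'
  field_simp
  ring

lemma deriv_nu_div (hx : 0 < x.2) (α : ℝ) (i : Fin n) :
    deriv (nu i x) α / nuLast x α = (-if i = 0 then 1 else 0) / x.2
      + shift x α i * shift x α 0 / (x.2 * dist0 x α ^ 2) := by
  have hd := (dist0_pos hx α).ne'
  have h : HasDerivAt (nu i x) _ α := (hasDerivAt_shift α i).div (hasDerivAt_dist0 hx α) hd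
  rw [h.deriv, nuLast]
  have := hx.ne'
  field_simp
  ring

lemma nu_div_nuLast (hx : 0 < x.2) (α : ℝ) (i : Fin n) :
    nu i x α / nuLast x α = shift x α i / x.2 := by
  rw [nu, nuLast, div_div_div_cancel_right₀ (dist0_pos hx α).ne']

lemma abs_shift_le {A d α : ℝ} (hA : ∀ i, |x.1 i| ≤ A) (hα : |α| ≤ d) (i : Fin n) :
    |shift x α i| ≤ A + d := by
  have h1 := hA i
  unfold shift
  split_ifs
  · exact (abs_sub _ _).trans (add_le_add h1 hα)
  · rw [sub_zero]
    linarith [abs_nonneg α]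

lemma abs_inv_nuLast_le {A d α : ℝ} (hx : 1 ≤ x.2) (hA : ∀ i, |x.1 i| ≤ A) (hα : |α| ≤ d) :
    |(nuLast x α)⁻¹| ≤ Real.sqrt (n * (A + d) ^ 2 + 1) := by
  have hx0 : 0 < x.2 := by linarith
  refine Real.abs_le_sqrt ?_
  rw [nuLast, inv_div, div_pow, sq_dist0 hx0, div_le_iff₀ (by positivity)]
  have h1 : ∑ i, shift x α i ^ 2 ≤ n * (A + d) ^ 2 := by
    refine (Finset.sum_le_card_nsmul _ _ ((A + d) ^ 2) fun i _ => ?_).trans (by simp)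
    exact sq_le_sq' (abs_le.1 (abs_shift_le hA hα i)).1 (abs_le.1 (abs_shift_le hA hα i)).2
  have h2 : 0 ≤ (n : ℝ) * (A + d) ^ 2 := by positivity
  nlinarith [mul_le_mul_of_nonneg_left (one_le_pow₀ hx : 1 ≤ x.2 ^ 2) h2]

end DirectionField

/-! ### The matrices of the projected system -/

lemma exists_bound_Psi (N : ℕ) (d : ℝ) : ∃ B : ℝ, 0 ≤ B ∧ ∀ s : Fin N, ∀ α ∈ Icc (-d) d,
    |Psi d s α| ≤ B ∧ |deriv (Psi d s) α| ≤ B := by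
  have h : ∀ s : Fin N, ∃ B : ℝ, ∀ α ∈ Icc (-d) d,
      |Psi d s α| ≤ B ∧ |deriv (Psi d s) α| ≤ B := by
    intro s
    obtain ⟨B₁, h₁⟩ := (isCompact_Icc (a := -d) (b := d)).exists_bound_of_continuousOn
      (continuous_Psi d s).continuousOn
    obtain ⟨B₂, h₂⟩ := (isCompact_Icc (a := -d) (b := d)).exists_bound_of_continuousOn
      (continuous_deriv_Psi d s).continuousOn
    exact ⟨max B₁ B₂, fun α hα => ⟨(h₁ α hα).trans (le_max_left _ _),
      (h₂ α hα).trans (le_max_right _ _)⟩⟩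
  choose B hB using h
  refine ⟨∑ s, |B s|, Finset.sum_nonneg fun _ _ => abs_nonneg _, fun s α hα => ?_⟩
  have h1 : B s ≤ ∑ s, |B s| := (le_abs_self _).trans
    (Finset.single_le_sum (f := fun s => |B s|) (fun _ _ => abs_nonneg _) (Finset.mem_univ s))
  exact ⟨(hB s α hα).1.trans h1, (hB s α hα).2.trans h1⟩

section Matrices

variable {n : ℕ} [NeZero n]

lemma abs_matALast_le {N : ℕ} {A d B : ℝ} (hA : 0 ≤ A) (hd : 0 ≤ d) (hB : 0 ≤ B)
    (hPsi : ∀ s : Fin N, ∀ α ∈ Icc (-d) d, |Psi d s α| ≤ B ∧ |deriv (Psi d s) α| ≤ B)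
    {x : (Fin n → ℝ) × ℝ} (hx : 0 < x.2) (hxA : ∀ i, |x.1 i| ≤ A) (k s : Fin N) :
    |matALast N d x k s| ≤ (A + d) * B * B * (2 * d) / x.2 ^ 2 := by
  simp only [matALast, Matrix.of_apply]
  rw [← Real.norm_eq_abs]
  refine (intervalIntegral.norm_integral_le_of_norm_le_const
    (C := (A + d) / x.2 ^ 2 * B * B) fun α hα => ?_).trans (le_of_eq ?_)
  · rw [uIoc_of_le (by linarith)] at hα
    have hα' : α ∈ Icc (-d) d := ⟨hα.1.le, hα.2⟩
    rw [deriv_nuLast_div hx, norm_mul, norm_mul, norm_div]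
    have h1 : x.2 ^ 2 ≤ ‖(∑ i, shift x α i ^ 2) + x.2 ^ 2‖ := by
      rw [Real.norm_of_nonneg (dist0_sq_pos hx α).le]
      exact le_add_of_nonneg_left (Finset.sum_nonneg fun _ _ => sq_nonneg _)
    have h2 : ‖shift x α 0‖ ≤ A + d := abs_shift_le hxA (abs_le.2 hα') 0
    have h3 := (hPsi s α hα').1
    have h4 := (hPsi k α hα').1
    gcongr <;> assumption
  · rw [abs_of_nonneg (by linarith)]
    ring

lemma abs_matA_le {N : ℕ} {A d B : ℝ} (hA : 0 ≤ A) (hd : 0 ≤ d) (hB : 0 ≤ B)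
    (hPsi : ∀ s : Fin N, ∀ α ∈ Icc (-d) d, |Psi d s α| ≤ B ∧ |deriv (Psi d s) α| ≤ B)
    {x : (Fin n → ℝ) × ℝ} (hx : 1 ≤ x.2) (hxA : ∀ i, |x.1 i| ≤ A) (i : Fin n) (k s : Fin N) :
    |matA N d i x k s| ≤ ((A + d) * B + (1 + (A + d) * (A + d)) * B) * B * (2 * d) := by
  have hx0 : 0 < x.2 := by linarith
  simp only [matA, Matrix.of_apply]
  rw [← Real.norm_eq_abs]
  refine (intervalIntegral.norm_integral_le_of_norm_le_const
    (C := ((A + d) * B + (1 + (A + d) * (A + d)) * B) * B) fun α hα => ?_).trans (le_of_eq ?_)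
  · rw [uIoc_of_le (by linarith)] at hα
    have hα' : α ∈ Icc (-d) d := ⟨hα.1.le, hα.2⟩
    have h0 := abs_shift_le hxA (abs_le.2 hα') 0
    have hi := abs_shift_le hxA (abs_le.2 hα') i
    have h1 : |shift x α i / x.2| ≤ A + d := by
      rw [abs_div, abs_of_pos hx0]
      exact (div_le_self (abs_nonneg _) hx).trans hi
    have h2 : |(-if i = 0 then (1 : ℝ) else 0) / x.2| ≤ 1 := by
      rw [abs_div, abs_of_pos hx0]
      refine (div_le_self (abs_nonneg _) hx).trans ?_
      split_ifs <;> simp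
    have h3 : |shift x α i * shift x α 0 / (x.2 * dist0 x α ^ 2)| ≤ (A + d) * (A + d) := by
      have h4 : 1 ≤ x.2 * dist0 x α ^ 2 :=
        one_le_mul_of_one_le_of_one_le hx (one_le_pow₀ (hx.trans (le_dist0 x α)))
      rw [abs_div, abs_mul, abs_of_pos (by linarith : 0 < x.2 * dist0 x α ^ 2)]
      exact (div_le_self (by positivity) h4).trans (by gcongr)
    rw [nu_div_nuLast hx0, deriv_nu_div hx0, norm_mul]
    simp only [Real.norm_eq_abs]
    have h5 := (hPsi s α hα').1
    have h6 := (hPsi s α hα').2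
    have h7 := (hPsi k α hα').1
    have h8 := (abs_add_le _ _).trans (add_le_add h2 h3)
    refine mul_le_mul ((abs_add_le _ _).trans ?_) h7 (abs_nonneg _) (by positivity)
    rw [abs_mul, abs_mul]
    gcongr
  · rw [abs_of_nonneg (by linarith)]
    ring

lemma continuousOn_matD (N : ℕ) (d : ℝ) :
    ContinuousOn (fun x : (Fin n → ℝ) × ℝ => matD N d x) {x | 0 < x.2} := by
  rw [continuousOn_iff_continuous_domRestrict]
  refine continuous_const.add (continuous_matrix fun k s => ?_)
  have h : ∀ x : {x : (Fin n → ℝ) × ℝ | 0 < x.2}, matALast N d x.1 k s = ∫ α in (-d)..d,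
      shift x.1 α 0 / ((∑ i, shift x.1 α i ^ 2) + x.1.2 ^ 2) * Psi d s α * Psi d k α := by
    intro x
    simp only [matALast, Matrix.of_apply, deriv_nuLast_div x.2]
  simp only [h]
  refine intervalIntegral.continuous_parametric_intervalIntegral_of_continuous' ?_ _ _
  have hsh : ∀ i, Continuous fun p : {x : (Fin n → ℝ) × ℝ | 0 < x.2} × ℝ =>
      shift p.1.1 p.2 i := by
    intro i
    unfold shift
    split_ifs <;> fun_prop
  have h1 := continuous_Psi d s
  have h2 := continuous_Psi d k
  refine ((Continuous.div (hsh 0) ?_ fun p => (dist0_sq_pos p.1.2 p.2).ne').mul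
    (h1.comp continuous_snd)).mul (h2.comp continuous_snd)
  exact (continuous_finsetSum _ fun i _ => (hsh i).pow 2).add (by fun_prop)

end Matrices

/-! ### The prism -/

lemma closure_Omega_subset (n : ℕ) (A a b : ℝ) :
    closure (Omega n A a b) ⊆ (Set.univ.pi fun _ => Icc (-A) A) ×ˢ Icc a b := by
  refine closure_minimal (prod_mono (pi_mono fun _ _ => Ioo_subset_Icc_self) Ioo_subset_Icc_self) ?_
  exact (isClosed_set_pi fun _ _ => isClosed_Icc).prod isClosed_Icc

lemma abs_fst_le_of_mem_closure {n : ℕ} {A a b : ℝ} {x : (Fin n → ℝ) × ℝ}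
    (hx : x ∈ closure (Omega n A a b)) (i : Fin n) : |x.1 i| ≤ A :=
  abs_le.2 ((closure_Omega_subset n A a b hx).1 i (mem_univ i))

lemma le_snd_of_mem_closure {n : ℕ} {A a b : ℝ} {x : (Fin n → ℝ) × ℝ}
    (hx : x ∈ closure (Omega n A a b)) : a ≤ x.2 :=
  (closure_Omega_subset n A a b hx).2.1

lemma isCompact_closure_Omega (n : ℕ) (A a b : ℝ) : IsCompact (closure (Omega n A a b)) :=
  ((isCompact_univ_pi fun _ => isCompact_Icc).prod isCompact_Icc).of_isClosed_subset
    isClosed_closure (closure_Omega_subset n A a b)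

/-- Since `Aₙ₊₁(x)` decays like `y⁻²` and `det M_N = 1`, the matrix `D_N(x)` is invertible for
large `y`. -/
lemma exists_isThreshold (n N : ℕ) [NeZero n] {A d : ℝ} (hA : 0 < A) (hd : 0 < d) :
    ∃ a₀, IsThreshold n N A d a₀ := by
  obtain ⟨B, hB, hPsi⟩ := exists_bound_Psi N d
  have hopen : IsOpen {M : Fin N → Fin N → ℝ | Matrix.det (Matrix.of M) ≠ 0} :=
    isOpen_ne_fun (Continuous.matrix_det continuous_id) continuous_const
  obtain ⟨ε, hε, hball⟩ := Metric.isOpen_iff.1 hopen (fun k s => matM N d k s)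
    (by
      change (matM N d).det ≠ 0
      rw [det_matM N hd]
      exact one_ne_zero)
  set C := (A + d) * B * B * (2 * d) with hC
  have hC0 : 0 ≤ C := by positivity
  -- For `y ≥ a₀ > 1` the perturbation is at most `C / y² ≤ C / a₀ < ε`.
  refine ⟨C / ε + 2, by have := div_nonneg hC0 hε.le; linarith, fun a b ha _ x hx => ?_⟩
  have hCε := div_nonneg hC0 hε.le
  have hxa := le_snd_of_mem_closure hx
  have hx1 : 1 ≤ x.2 := by linarith
  have hx0 : 0 < x.2 := by linarith
  rw [Matrix.isUnit_iff_isUnit_det, isUnit_iff_ne_zero]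
  refine hball (a := fun k s => matD N d x k s) ?_
  rw [Metric.mem_ball, dist_pi_lt_iff hε]
  intro k
  rw [dist_pi_lt_iff hε]
  intro s
  rw [Real.dist_eq, matD, Matrix.add_apply, add_sub_cancel_left]
  refine (abs_matALast_le hA.le hd.le hB hPsi hx0 (abs_fst_le_of_mem_closure hx) k s).trans_lt ?_
  rw [div_lt_iff₀ (by positivity), ← hC]
  have h1 : C / ε < x.2 := by linarith
  rw [div_lt_iff₀ hε] at h1
  nlinarith [mul_le_mul_of_nonneg_left hx1 (mul_pos hε hx0).le]

/-- On the compact closed prism the inverses of the matrices `D_N(x)` are uniformly bounded. -/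
lemma exists_bound_inv_matD {n : ℕ} [NeZero n] (N : ℕ) {A a b : ℝ} (d : ℝ) (ha : 0 < a)
    (hunit : ∀ x ∈ closure (Omega n A a b), IsUnit (matD N d x)) :
    ∃ C : ℝ, 0 ≤ C ∧ ∀ x ∈ closure (Omega n A a b), ∀ k s, |(matD N d x)⁻¹ k s| ≤ C := by
  have hcont : ContinuousOn (fun x : (Fin n → ℝ) × ℝ => matD N d x) (closure (Omega n A a b)) :=
    (continuousOn_matD N d).mono fun x hx => ha.trans_le (le_snd_of_mem_closure hx)
  have hdet : ContinuousOn (fun x : (Fin n → ℝ) × ℝ => (matD N d x).det)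
      (closure (Omega n A a b)) :=
    (Continuous.matrix_det continuous_id).comp_continuousOn hcont
  have hadj : ContinuousOn (fun x : (Fin n → ℝ) × ℝ => (matD N d x).adjugate)
      (closure (Omega n A a b)) :=
    (Continuous.matrix_adjugate continuous_id).comp_continuousOn hcont
  have hbound : ∀ p : Fin N × Fin N, ∃ C : ℝ, ∀ x ∈ closure (Omega n A a b),
      ‖(matD N d x).det⁻¹ * (matD N d x).adjugate p.1 p.2‖ ≤ C := fun p =>
    (isCompact_closure_Omega n A a b).exists_bound_of_continuousOn
      ((hdet.inv₀ fun x hx => ((Matrix.isUnit_iff_isUnit_det _).1 (hunit x hx)).ne_zero).mul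
        ((continuous_apply_apply p.1 p.2).comp_continuousOn hadj))
  choose C hC using hbound
  refine ⟨∑ p, |C p|, Finset.sum_nonneg fun _ _ => abs_nonneg _, fun x hx k s => ?_⟩
  rw [Matrix.inv_def, Ring.inverse_eq_inv', Matrix.smul_apply, smul_eq_mul]
  exact ((hC (k, s) x hx).trans (le_abs_self _)).trans (Finset.single_le_sum
    (f := fun p => |C p|) (fun _ _ => abs_nonneg _) (Finset.mem_univ (k, s)))

/-! ### Local Lipschitz continuity of the nonlinearity -/

/-- `κ(α, β)` is bounded by `L` together with its partial derivative `κ₁ = ∂κ/∂α` on `[-d, d]²`,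
and both are continuous in `β`. At `α = ±d` the derivative is one-sided. -/
def IsC1Kernel (d L : ℝ) (κ κ₁ : ℝ → ℝ → ℝ) : Prop :=
  ∀ α ∈ Icc (-d) d, ContinuousOn (κ α) (Icc (-d) d) ∧ ContinuousOn (κ₁ α) (Icc (-d) d) ∧
    ∀ β ∈ Icc (-d) d, |κ α β| ≤ L ∧ |κ₁ α β| ≤ L ∧
      HasDerivWithinAt (fun t => κ t β) (κ₁ α β) (Icc (-d) d) α

lemma exists_isC1Kernel {n : ℕ} {A a b d : ℝ} (hA : 0 < A) (hab : a < b) (hd : 0 < d)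
    {K : (Fin n → ℝ) × ℝ → ℝ → ℝ → ℝ}
    (hK : ContDiffOn ℝ 2 (fun p : ((Fin n → ℝ) × ℝ) × ℝ × ℝ => K p.1 p.2.1 p.2.2)
      (closure (Omega n A a b) ×ˢ Icc (-d) d ×ˢ Icc (-d) d)) :
    ∃ L, 0 ≤ L ∧ ∃ K₁ : (Fin n → ℝ) × ℝ → ℝ → ℝ → ℝ,
      ∀ x ∈ closure (Omega n A a b), IsC1Kernel d L (K x) (K₁ x) := by
  set S := closure (Omega n A a b) ×ˢ Icc (-d) d ×ˢ Icc (-d) d with hS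
  set f : ((Fin n → ℝ) × ℝ) × ℝ × ℝ → ℝ := fun p => K p.1 p.2.1 p.2.2 with hf
  have hconv : Convex ℝ (Omega n A a b) :=
    (convex_pi fun _ _ => convex_Ioo _ _).prod (convex_Ioo _ _)
  have hopen : IsOpen (Omega n A a b) :=
    (isOpen_set_pi finite_univ fun _ _ => isOpen_Ioo).prod isOpen_Ioo
  have hne : (interior (closure (Omega n A a b))).Nonempty := by
    refine Nonempty.mono (interior_maximal subset_closure hopen) ?_
    exact ⟨(fun _ => 0, (a + b) / 2), ⟨fun _ _ => ⟨by simpa using hA, hA⟩,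
      ⟨by simp only; linarith, by simp only; linarith⟩⟩⟩
  have hdd : -d < d := by linarith
  have huniq : UniqueDiffOn ℝ S := (uniqueDiffOn_convex hconv.closure hne).prod
    ((uniqueDiffOn_Icc hdd).prod (uniqueDiffOn_Icc hdd))
  have hScomp : IsCompact S :=
    (isCompact_closure_Omega n A a b).prod (isCompact_Icc.prod isCompact_Icc)
  set f₁ : ((Fin n → ℝ) × ℝ) × ℝ × ℝ → ℝ := fun p => fderivWithin ℝ f S p (0, 1, 0) with hf₁
  have hf₁c : ContinuousOn f₁ S :=
    (hK.continuousOn_fderivWithin huniq (by norm_num)).clm_apply continuousOn_const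
  obtain ⟨L₀, hL₀⟩ := hScomp.exists_bound_of_continuousOn hK.continuousOn
  obtain ⟨L₁, hL₁⟩ := hScomp.exists_bound_of_continuousOn hf₁c
  refine ⟨max 0 (max L₀ L₁), le_max_left _ _, fun x α β => f₁ (x, α, β), fun x hx α hα =>
    ⟨?_, ?_, fun β hβ => ⟨?_, ?_, ?_⟩⟩⟩
  · exact hK.continuousOn.comp (f := fun β => (x, α, β)) (by fun_prop) fun β hβ => ⟨hx, hα, hβ⟩
  · exact hf₁c.comp (f := fun β => (x, α, β)) (by fun_prop) fun β hβ => ⟨hx, hα, hβ⟩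
  · exact (hL₀ (x, α, β) ⟨hx, hα, hβ⟩).trans ((le_max_left _ _).trans (le_max_right _ _))
  · exact (hL₁ (x, α, β) ⟨hx, hα, hβ⟩).trans ((le_max_right _ _).trans (le_max_right _ _))
  · have h1 := ((hK.differentiableOn (by norm_num)) (x, α, β) ⟨hx, hα, hβ⟩).hasFDerivWithinAt
    have h2 : HasDerivWithinAt (fun t : ℝ => (x, t, β)) (0, 1, 0) (Icc (-d) d) α :=
      (hasDerivWithinAt_const _ _ x).prodMk
        ((hasDerivWithinAt_id _ _).prodMk (hasDerivWithinAt_const _ _ β))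
    have hmaps : MapsTo (fun t : ℝ => (x, t, β)) (Icc (-d) d) S := fun t ht => ⟨hx, ht, hβ⟩
    exact h1.comp_hasDerivWithinAt α h2 hmaps

namespace IsC1Kernel

variable {d L : ℝ} {κ κ₁ : ℝ → ℝ → ℝ}

lemma intervalIntegrable {k u : ℝ → ℝ} (hd : 0 ≤ d) (hk : ContinuousOn k (Icc (-d) d))
    (hu : Continuous u) : IntervalIntegrable (fun β => k β * u β) volume (-d) d := by
  refine ContinuousOn.intervalIntegrable ?_
  rw [uIcc_of_le (by linarith)]
  exact hk.mul hu.continuousOn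

lemma hasDerivAt_integral (h : IsC1Kernel d L κ κ₁) {u : ℝ → ℝ} (hu : Continuous u) {α : ℝ}
    (hα : α ∈ Ioo (-d) d) :
    HasDerivAt (fun t => ∫ β in (-d)..d, κ t β * u β) (∫ β in (-d)..d, κ₁ α β * u β) α := by
  have hd : 0 ≤ d := by linarith [hα.1, hα.2]
  have hnhds : Ioo (-d) d ∈ nhds α := Ioo_mem_nhds hα.1 hα.2
  have hsub : uIoc (-d) d ⊆ Icc (-d) d := by
    rw [uIoc_of_le (by linarith)]
    exact Ioc_subset_Icc_self
  have hint : ∀ t ∈ Icc (-d) d, IntervalIntegrable (fun β => κ t β * u β) volume (-d) d :=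
    fun t ht => intervalIntegrable hd (h t ht).1 hu
  refine (intervalIntegral.hasDerivAt_integral_of_dominated_loc_of_deriv_le
    (F := fun t β => κ t β * u β) (F' := fun t β => κ₁ t β * u β)
    (bound := fun β => L * |u β|) hnhds ?_ (hint α (Ioo_subset_Icc_self hα)) ?_ ?_ ?_ ?_).2
  · filter_upwards [hnhds] with t ht
    exact (hint t (Ioo_subset_Icc_self ht)).def'.aestronglyMeasurable
  · exact (intervalIntegrable hd (h α (Ioo_subset_Icc_self hα)).2.1 hu).def'.aestronglyMeasurable
  · refine Filter.Eventually.of_forall fun β hβ t ht => ?_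
    rw [norm_mul]
    exact mul_le_mul_of_nonneg_right
      ((h t (Ioo_subset_Icc_self ht)).2.2 β (hsub hβ)).2.1 (abs_nonneg _)
  · exact (continuous_const.mul hu.abs).intervalIntegrable _ _
  · refine Filter.Eventually.of_forall fun β hβ t ht => ?_
    exact (((h t (Ioo_subset_Icc_self ht)).2.2 β (hsub hβ)).2.2.hasDerivAt
      (Icc_mem_nhds ht.1 ht.2)).mul_const _

lemma abs_integral_mul_le {k u : ℝ → ℝ} {E : ℝ} (hd : 0 ≤ d) (hL : 0 ≤ L)
    (hk : ∀ β ∈ Icc (-d) d, |k β| ≤ L) (hu : ∀ β ∈ Icc (-d) d, |u β| ≤ E) :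
    |∫ β in (-d)..d, k β * u β| ≤ L * E * (2 * d) := by
  rw [← Real.norm_eq_abs]
  refine (intervalIntegral.norm_integral_le_of_norm_le_const
    (C := L * E) fun β hβ => ?_).trans (le_of_eq ?_)
  · rw [uIoc_of_le (by linarith)] at hβ
    have hβ' : β ∈ Icc (-d) d := ⟨hβ.1.le, hβ.2⟩
    rw [norm_mul]
    exact mul_le_mul (hk β hβ') (hu β hβ') (abs_nonneg _) hL
  · rw [abs_of_nonneg (by linarith)]
    ring

lemma abs_integral_sub_le {k u v : ℝ → ℝ} {E : ℝ} (hd : 0 ≤ d) (hL : 0 ≤ L)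
    (hkc : ContinuousOn k (Icc (-d) d)) (hk : ∀ β ∈ Icc (-d) d, |k β| ≤ L)
    (hu : Continuous u) (hv : Continuous v) (huv : ∀ β ∈ Icc (-d) d, |u β - v β| ≤ E) :
    |(∫ β in (-d)..d, k β * u β) - ∫ β in (-d)..d, k β * v β| ≤ L * E * (2 * d) := by
  rw [← intervalIntegral.integral_sub (intervalIntegrable hd hkc hu)
    (intervalIntegrable hd hkc hv)]
  simp only [← mul_sub]
  exact abs_integral_mul_le hd hL hk huv

end IsC1Kernel

lemma abs_mul_sub_mul_le {p p' q q' P Q δp δq : ℝ} (hp : |p| ≤ P) (hq' : |q'| ≤ Q)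
    (hpp : |p - p'| ≤ δp) (hqq : |q - q'| ≤ δq) : |p * q - p' * q'| ≤ P * δq + δp * Q := by
  have hP := (abs_nonneg _).trans hp
  have hδ := (abs_nonneg _).trans hpp
  rw [show p * q - p' * q' = p * (q - q') + (p - p') * q' by ring]
  refine (abs_add_le _ _).trans ?_
  rw [abs_mul, abs_mul]
  gcongr

lemma abs_exp_sub_exp_le {s t M : ℝ} (hs : |s| ≤ M) (ht : |t| ≤ M) :
    |Real.exp s - Real.exp t| ≤ Real.exp M * |s - t| := by
  refine (convex_Icc (-M) M).norm_image_sub_le_of_norm_deriv_le (f := Real.exp)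
    (fun u _ => Real.differentiableAt_exp) (fun u hu => ?_) (abs_le.1 ht) (abs_le.1 hs)
  rw [Real.deriv_exp, Real.norm_of_nonneg (Real.exp_pos _).le]
  exact Real.exp_le_exp.2 hu.2

section Expand

variable {N : ℕ} {d : ℝ}

lemma expand_sub (w v : Fin N → ℝ) (α : ℝ) :
    expand d w α - expand d v α = expand d (w - v) α := by
  simp only [expand, Pi.sub_apply, sub_mul, Finset.sum_sub_distrib]

lemma continuous_expand (w : Fin N → ℝ) : Continuous (expand d w) :=
  continuous_finsetSum _ fun s _ => continuous_const.mul (continuous_Psi d s)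

lemma abs_sum_mul_le {B : ℝ} {f : Fin N → ℝ} (hf : ∀ s, |f s| ≤ B) (w : Fin N → ℝ) :
    |∑ s, w s * f s| ≤ N * B * ‖w‖ := by
  refine (Finset.abs_sum_le_sum_abs _ _).trans
    ((Finset.sum_le_card_nsmul _ _ (‖w‖ * B) fun s _ => ?_).trans (le_of_eq ?_))
  · rw [abs_mul]
    exact mul_le_mul (norm_le_pi_norm w s) (hf s) (abs_nonneg _) (norm_nonneg _)
  · simp
    ring

lemma hasDerivAt_expand (w : Fin N → ℝ) (α : ℝ) :
    HasDerivAt (expand d w) (∑ s, w s * deriv (Psi d s) α) α :=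
  HasDerivAt.fun_sum fun s _ => (differentiable_Psi d s α).hasDerivAt.const_mul _

end Expand

/-- On bounded sets of coefficients `w` the `α`-derivative of the scattering term is bounded and
Lipschitz continuous in `w`, uniformly in `x` and `α`. -/
lemma exists_bound_deriv_scatter {n N : ℕ} {d L R : ℝ} (hd : 0 ≤ d) (hL : 0 ≤ L) (hR : 0 ≤ R)
    {X : Set ((Fin n → ℝ) × ℝ)} {K K₁ : (Fin n → ℝ) × ℝ → ℝ → ℝ → ℝ}
    (hK : ∀ x ∈ X, IsC1Kernel d L (K x) (K₁ x)) :
    ∃ C, 0 ≤ C ∧ ∀ x ∈ X, ∀ α ∈ Ioo (-d) d, ∀ w v : Fin N → ℝ, ‖w‖ ≤ R → ‖v‖ ≤ R →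
      |deriv (scatter d K w x) α| ≤ C ∧
      |deriv (scatter d K w x) α - deriv (scatter d K v x) α| ≤ C * ‖w - v‖ := by
  obtain ⟨B, hB, hPsi⟩ := exists_bound_Psi N d
  set Q := N * B with hQ
  have hQ0 : 0 ≤ Q := by positivity
  set E := Real.exp (Q * R) with hE
  have hE0 : 0 ≤ E := (Real.exp_pos _).le
  set G := L * E * (2 * d) with hG
  have hG0 : 0 ≤ G := by positivity
  have hexpand : ∀ w : Fin N → ℝ, ‖w‖ ≤ R → ∀ α ∈ Icc (-d) d, |expand d w α| ≤ Q * R :=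
    fun w hw α hα => (abs_sum_mul_le (fun s => (hPsi s α hα).1) w).trans
      (mul_le_mul_of_nonneg_left hw hQ0)
  have hexp : ∀ w : Fin N → ℝ, ‖w‖ ≤ R → ∀ α ∈ Icc (-d) d, |Real.exp (expand d w α)| ≤ E ∧
      |Real.exp (-expand d w α)| ≤ E := by
    intro w hw α hα
    have h := abs_le.1 (hexpand w hw α hα)
    rw [Real.abs_exp, Real.abs_exp]
    exact ⟨Real.exp_le_exp.2 h.2, Real.exp_le_exp.2 (by linarith)⟩
  have hexpsub : ∀ w v : Fin N → ℝ, ∀ α ∈ Icc (-d) d,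
      |expand d w α - expand d v α| ≤ Q * ‖w - v‖ := by
    intro w v α hα
    rw [expand_sub]
    exact abs_sum_mul_le (fun s => (hPsi s α hα).1) _
  have hLip : ∀ w v : Fin N → ℝ, ‖w‖ ≤ R → ‖v‖ ≤ R → ∀ α ∈ Icc (-d) d,
      |Real.exp (expand d w α) - Real.exp (expand d v α)| ≤ E * (Q * ‖w - v‖) ∧
      |Real.exp (-expand d w α) - Real.exp (-expand d v α)| ≤ E * (Q * ‖w - v‖) := by
    intro w v hw hv α hα
    have h := hexpsub w v α hα
    refine ⟨(abs_exp_sub_exp_le (hexpand w hw α hα) (hexpand v hv α hα)).trans (by gcongr),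
      (abs_exp_sub_exp_le (M := Q * R) ?_ ?_).trans ?_⟩
    · rw [abs_neg]; exact hexpand w hw α hα
    · rw [abs_neg]; exact hexpand v hv α hα
    · rw [neg_sub_neg, abs_sub_comm]
      gcongr
  have hcont : ∀ w : Fin N → ℝ, Continuous fun β => Real.exp (expand d w β) := fun w =>
    Real.continuous_exp.comp (continuous_expand w)
  have hderiv : ∀ x ∈ X, ∀ α ∈ Ioo (-d) d, ∀ w : Fin N → ℝ, deriv (scatter d K w x) α
      = Real.exp (-expand d w α) * ((∫ β in (-d)..d, K₁ x α β * Real.exp (expand d w β))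
        - (∑ s, w s * deriv (Psi d s) α)
          * ∫ β in (-d)..d, K x α β * Real.exp (expand d w β)) := by
    intro x hx α hα w
    have h : HasDerivAt (scatter d K w x) _ α := ((hasDerivAt_expand w α).neg.exp).mul
      ((hK x hx).hasDerivAt_integral (hcont w) hα)
    rw [h.deriv, Pi.neg_apply]
    ring
  set I := G + Q * R * G with hI
  set I' := G * Q + (Q * R * (G * Q) + Q * G) with hI'
  have hI0 : 0 ≤ I := by positivity
  have hI'0 : 0 ≤ I' := by positivity
  refine ⟨E * I + (E * I' + E * Q * I), by positivity, fun x hx α hα w v hw hv => ?_⟩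
  have hα' := Ioo_subset_Icc_self hα
  obtain ⟨hc, hc₁, hk⟩ := hK x hx α hα'
  rw [hderiv x hx α hα w, hderiv x hx α hα v]
  have hGb : ∀ w : Fin N → ℝ, ‖w‖ ≤ R →
      |∫ β in (-d)..d, K x α β * Real.exp (expand d w β)| ≤ G ∧
      |∫ β in (-d)..d, K₁ x α β * Real.exp (expand d w β)| ≤ G := fun w hw =>
    ⟨IsC1Kernel.abs_integral_mul_le hd hL (fun β hβ => (hk β hβ).1) fun β hβ =>
      (hexp w hw β hβ).1,
    IsC1Kernel.abs_integral_mul_le hd hL (fun β hβ => (hk β hβ).2.1) fun β hβ =>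
      (hexp w hw β hβ).1⟩
  have hGs : |(∫ β in (-d)..d, K x α β * Real.exp (expand d w β))
        - ∫ β in (-d)..d, K x α β * Real.exp (expand d v β)| ≤ G * Q * ‖w - v‖ :=
    (IsC1Kernel.abs_integral_sub_le hd hL hc (fun β hβ => (hk β hβ).1) (hcont w) (hcont v)
      fun β hβ => (hLip w v hw hv β hβ).1).trans (le_of_eq (by rw [hG]; ring))
  have hG₁s : |(∫ β in (-d)..d, K₁ x α β * Real.exp (expand d w β))
        - ∫ β in (-d)..d, K₁ x α β * Real.exp (expand d v β)| ≤ G * Q * ‖w - v‖ :=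
    (IsC1Kernel.abs_integral_sub_le hd hL hc₁ (fun β hβ => (hk β hβ).2.1) (hcont w) (hcont v)
      fun β hβ => (hLip w v hw hv β hβ).1).trans (le_of_eq (by rw [hG]; ring))
  have hD : ∀ w : Fin N → ℝ, ‖w‖ ≤ R → |∑ s, w s * deriv (Psi d s) α| ≤ Q * R := fun w hw =>
    (abs_sum_mul_le (fun s => (hPsi s α hα').2) w).trans (mul_le_mul_of_nonneg_left hw hQ0)
  have hDs : |(∑ s, w s * deriv (Psi d s) α) - ∑ s, v s * deriv (Psi d s) α|
      ≤ Q * ‖w - v‖ := by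
    rw [← Finset.sum_sub_distrib]
    simp only [← sub_mul]
    exact abs_sum_mul_le (fun s => (hPsi s α hα').2) (w - v)
  have hIb : ∀ w : Fin N → ℝ, ‖w‖ ≤ R →
      |(∫ β in (-d)..d, K₁ x α β * Real.exp (expand d w β))
        - (∑ s, w s * deriv (Psi d s) α)
          * ∫ β in (-d)..d, K x α β * Real.exp (expand d w β)| ≤ I := by
    intro w hw
    refine (abs_sub _ _).trans (add_le_add (hGb w hw).2 ?_)
    rw [abs_mul]
    exact mul_le_mul (hD w hw) (hGb w hw).1 (abs_nonneg _) (by positivity)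
  constructor
  · rw [abs_mul]
    refine (mul_le_mul (hexp w hw α hα').2 (hIb w hw) (abs_nonneg _) hE0).trans ?_
    exact le_add_of_nonneg_right (by positivity)
  · have hprod := abs_mul_sub_mul_le (hD w hw) (hGb v hv).1 hDs hGs
    have hIs := (abs_sub _ _).trans (add_le_add hG₁s hprod)
    rw [sub_sub_sub_comm] at hIs
    refine (abs_mul_sub_mul_le (hexp w hw α hα').2 (hIb v hv) (hLip w v hw hv α hα').2
      hIs).trans ?_
    have h0 : 0 ≤ E * I * ‖w - v‖ := by positivity
    refine le_of_sub_nonneg (h0.trans (le_of_eq ?_))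
    rw [hI']
    ring

/-- The nonlinearity is Lipschitz continuous on bounded sets, uniformly on the prism. -/
lemma exists_lipschitz_nonlin {n N : ℕ} [NeZero n] {A a b d R : ℝ} (hA : 0 < A) (hd : 0 < d)
    (ha : 1 ≤ a) (hab : a < b) (hR : 0 ≤ R) {mu : (Fin n → ℝ) × ℝ → ℝ} (hmu : Continuous mu)
    {K : (Fin n → ℝ) × ℝ → ℝ → ℝ → ℝ}
    (hK : ContDiffOn ℝ 2 (fun p : ((Fin n → ℝ) × ℝ) × ℝ × ℝ => K p.1 p.2.1 p.2.2)
      (closure (Omega n A a b) ×ˢ Icc (-d) d ×ˢ Icc (-d) d)) :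
    ∃ C, 0 ≤ C ∧ ∀ x ∈ closure (Omega n A a b), ∀ w v : Fin N → ℝ, ‖w‖ ≤ R → ‖v‖ ≤ R →
      ∀ k, |nonlin d mu K w x k - nonlin d mu K v x k| ≤ C * ‖w - v‖ := by
  obtain ⟨L, hL, K₁, hker⟩ := exists_isC1Kernel hA hab hd hK
  obtain ⟨C, hC, hS⟩ := exists_bound_deriv_scatter (N := N) hd.le hL hR hker
  obtain ⟨B, hB, hPsi⟩ := exists_bound_Psi N d
  obtain ⟨M, hM⟩ := (isCompact_closure_Omega n A a b).exists_bound_of_continuousOn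
    hmu.continuousOn
  have hM0 : 0 ≤ |M| := abs_nonneg _
  set T := Real.sqrt (n * (A + d) ^ 2 + 1) with hT
  have hT0 : 0 ≤ T := Real.sqrt_nonneg _
  refine ⟨|M| * T * B * C * (2 * d), by positivity, fun x hx w v hw hv k => ?_⟩
  have hx1 : 1 ≤ x.2 := ha.trans (le_snd_of_mem_closure hx)
  have hx0 : 0 < x.2 := by linarith
  have hfac : ∀ α ∈ Icc (-d) d, |mu x / nuLast x α| ≤ |M| * T := fun α hα => by
    rw [div_eq_mul_inv, abs_mul]
    exact mul_le_mul ((hM x hx).trans (le_abs_self _))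
      (abs_inv_nuLast_le hx1 (abs_fst_le_of_mem_closure hx) (abs_le.2 hα)) (abs_nonneg _) hM0
  have hnu : Continuous fun α => mu x / nuLast x α := by
    simp only [nuLast]
    have := continuous_dist0 hx0
    refine continuous_const.div (continuous_const.div this fun α => (dist0_pos hx0 α).ne')
      fun α => (div_pos hx0 (dist0_pos hx0 α)).ne'
  have hint : ∀ w : Fin N → ℝ, ‖w‖ ≤ R → IntervalIntegrable
      (fun α => -(mu x / nuLast x α * deriv (scatter d K w x) α) * Psi d k α)
      volume (-d) d := by
    intro w hw
    rw [intervalIntegrable_iff_integrableOn_Ioo_of_le (by linarith)]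
    refine Measure.integrableOn_of_bounded (M := |M| * T * C * B) (by simp) ?_ ?_
    · exact ((hnu.measurable.mul (measurable_deriv _)).neg.mul
        (continuous_Psi d k).measurable).aestronglyMeasurable
    · refine (ae_restrict_mem measurableSet_Ioo).mono fun α hα => ?_
      have hα' := Ioo_subset_Icc_self hα
      rw [norm_mul, norm_neg, norm_mul]
      have h1 := hfac α hα'
      have h2 := (hS x hx α hα w w hw hw).1
      have h3 := (hPsi k α hα').1
      simp only [Real.norm_eq_abs]
      gcongr
  simp only [nonlin]
  rw [← intervalIntegral.integral_sub (hint w hw) (hint v hv), ← Real.norm_eq_abs,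
    intervalIntegral.integral_of_le (by linarith), integral_Ioc_eq_integral_Ioo]
  refine (norm_setIntegral_le_of_norm_le_const (C := |M| * T * B * (C * ‖w - v‖))
    (by simp) fun α hα => ?_).trans (le_of_eq ?_)
  · have hα' := Ioo_subset_Icc_self hα
    rw [show ∀ c p q r : ℝ, -(c * p) * r - -(c * q) * r = -(c * r * (p - q)) by intros; ring,
      norm_neg, norm_mul, norm_mul]
    have h1 := hfac α hα'
    have h2 := (hS x hx α hα w v hw hv).2
    have h3 := (hPsi k α hα').1
    simp only [Real.norm_eq_abs]
    gcongr
  · simp [hd.le]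
    ring

/-! ### Grönwall's inequality for absolutely continuous functions -/

/-- Absolutely continuous functions that vanish at `a` and whose derivatives are bounded, almost
everywhere, by a multiple of the sum of their absolute values, vanish identically. -/
lemma eq_zero_of_ae_abs_deriv_le {ι : Type*} {S : Finset ι} {v : ι → ℝ → ℝ} {a b C : ℝ}
    (hac : ∀ i ∈ S, AbsolutelyContinuousOnInterval (v i) a b) (h0 : ∀ i ∈ S, v i a = 0)
    (hab : a ≤ b)
    (hder : ∀ i ∈ S, ∀ᵐ y ∂(volume.restrict (Ioo a b)), |deriv (v i) y| ≤ C * ∑ j ∈ S, |v j y|) :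
    ∀ i ∈ S, ∀ y ∈ Icc a b, v i y = 0 := by
  set φ : ℝ → ℝ := fun y => ∑ j ∈ S, |v j y| with hφ
  have hφc : ContinuousOn φ (Icc a b) := by
    refine continuousOn_finsetSum _ fun j hj => ContinuousOn.abs ?_
    simpa [uIcc_of_le hab] using (hac j hj).continuousOn
  have hφ0 : ∀ y, 0 ≤ φ y := fun y => Finset.sum_nonneg fun _ _ => abs_nonneg _
  -- A continuous extension of `φ` makes its primitive differentiable up to the endpoints.
  set ψ : ℝ → ℝ := IccExtend hab ((Icc a b).domRestrict φ) with hψ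
  have hψc : Continuous ψ := (continuousOn_iff_continuous_domRestrict.1 hφc).Icc_extend'
  have hψφ : ∀ y ∈ Icc a b, ψ y = φ y := fun y hy => by
    rw [hψ, IccExtend_of_mem hab _ hy]
    rfl
  have hv : ∀ i ∈ S, ∀ y ∈ Icc a b, |v i y| ≤ C * ∫ t in a..y, ψ t := by
    intro i hi y hy
    have hsub : uIcc a y ⊆ uIcc a b := by
      rw [uIcc_of_le hy.1, uIcc_of_le hab]
      exact Icc_subset_Icc_right hy.2
    have hFTC := ((hac i hi).mono hsub).integral_deriv_eq_sub
    rw [h0 i hi, sub_zero] at hFTC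
    rw [← hFTC, ← intervalIntegral.integral_const_mul, ← Real.norm_eq_abs]
    refine intervalIntegral.norm_integral_le_of_norm_le hy.1 ?_
      ((continuous_const.mul hψc).intervalIntegrable _ _)
    rw [← ae_restrict_iff' measurableSet_Ioc, ← restrict_Ioo_eq_restrict_Ioc]
    filter_upwards [ae_restrict_of_ae_restrict_of_subset (Ioo_subset_Ioo_right hy.2) (hder i hi),
      ae_restrict_mem measurableSet_Ioo] with t ht hty
    rw [hψφ t ⟨hty.1.le, hty.2.le.trans hy.2⟩]
    exact ht
  have hψ0 : ∀ y, 0 ≤ ψ y := fun y => hφ0 _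
  set Φ : ℝ → ℝ := fun y => ∫ t in a..y, ψ t with hΦ
  have hΦ' : ∀ y, HasDerivAt Φ (ψ y) y := fun y => intervalIntegral.integral_hasDerivAt_right
    (hψc.intervalIntegrable _ _) (hψc.stronglyMeasurableAtFilter _ _) hψc.continuousAt
  have hΦ0 : ∀ y ∈ Icc a b, Φ y = 0 := by
    refine eq_zero_of_abs_deriv_le_mul_abs_self_of_eq_zero_right (K := S.card * C)
      (fun y _ => (hΦ' y).continuousAt.continuousWithinAt)
      (fun y _ => (hΦ' y).hasDerivWithinAt) intervalIntegral.integral_same fun y hy => ?_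
    have hy' : y ∈ Icc a b := Ico_subset_Icc_self hy
    rw [Real.norm_of_nonneg (hψ0 y), hψφ y hy',
      Real.norm_of_nonneg (intervalIntegral.integral_nonneg hy.1 fun t _ => hψ0 t), mul_assoc,
      ← nsmul_eq_mul]
    exact Finset.sum_le_card_nsmul _ _ _ fun i hi => hv i hi y hy'
  intro i hi y hy
  have h := hv i hi y hy
  rw [show (∫ t in a..y, ψ t) = 0 from hΦ0 y hy, mul_zero] at h
  exact abs_nonpos_iff.1 h

/-! ### Uniqueness for the semi-discrete problem -/

section Grid

variable {n : ℕ} {A a b y : ℝ} {m : ℕ} {J : Fin n → ℕ}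

lemma step_pos (hA : 0 < A) (hm : 1 < m) : 0 < step A m := by
  have : (0 : ℝ) < m := by exact_mod_cast (by omega : 0 < m)
  unfold step
  positivity

lemma pt_mem_Omega (hA : 0 < A) (hm : 1 < m) (hJ : Interior m J) (hy : y ∈ Ioo a b) :
    pt A m J y ∈ Omega n A a b := by
  refine ⟨fun i _ => ?_, hy⟩
  have hs := step_pos hA hm
  have hm0 : (m : ℝ) ≠ 0 := by exact_mod_cast (by omega : m ≠ 0)
  have h1 : (0 : ℝ) < J i := by exact_mod_cast (hJ i).1
  have h2 : (J i : ℝ) < m := by exact_mod_cast (hJ i).2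
  have h3 : (m : ℝ) * step A m = 2 * A := by
    unfold step
    field_simp
  refine ⟨by simp only [pt]; nlinarith, by simp only [pt]; nlinarith⟩

lemma Interior.onGrid (hJ : Interior m J) : OnGrid m J := fun i => (hJ i).2.le

lemma onGrid_update_of_interior (hJ : Interior m J) (i : Fin n) {r : ℕ} (hr : r ≤ m) :
    OnGrid m (Function.update J i r) := by
  intro k
  rcases eq_or_ne k i with rfl | h
  · simpa using hr
  · simpa [h] using (hJ k).2.le

lemma onBoundary_of_not_interior (hJ : OnGrid m J) (hn : ¬ Interior m J) (hy : y ∈ Ioo a b) :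
    OnBoundary a b m J y := by
  refine ⟨hJ, Or.inr (Or.inr ⟨?_, hy⟩)⟩
  simp only [Interior, not_forall] at hn
  obtain ⟨i, hi⟩ := hn
  have := hJ i
  exact ⟨i, by omega⟩

/-- The indices of the unknown functions of the semi-discrete system: an interior grid point
together with a component. -/
def interiorIndices (n N m : ℕ) : Finset ((Fin n → ℕ) × Fin N) :=
  (Fintype.piFinset fun _ => Finset.Ioo 0 m) ×ˢ Finset.univ

lemma mem_interiorIndices {N : ℕ} {s : Fin N} : (J, s) ∈ interiorIndices n N m ↔ Interior m J := by
  simp [interiorIndices, Interior]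

end Grid

lemma abs_mulVec_le {N : ℕ} {M : Matrix (Fin N) (Fin N) ℝ} {v : Fin N → ℝ} {c r : ℝ} (hc : 0 ≤ c)
    (hM : ∀ k s, |M k s| ≤ c) (hv : ∀ s, |v s| ≤ r) (k : Fin N) :
    |(M *ᵥ v) k| ≤ N * (c * r) := by
  rw [Matrix.mulVec, dotProduct]
  refine (Finset.abs_sum_le_sum_abs _ _).trans
    ((Finset.sum_le_card_nsmul _ _ (c * r) fun s _ => ?_).trans (by simp))
  rw [abs_mul]
  exact mul_le_mul (hM k s) (hv s) (abs_nonneg _) hc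

/-- Two functions of `H^{1,h}_N` that solve the semi-discrete system with the same boundary values
coincide. -/
lemma eq_of_solvesSystem {n N : ℕ} [NeZero n] {A a b d : ℝ} (hA : 0 < A) (hd : 0 < d)
    (ha : 1 ≤ a) (hab : a < b) {m : ℕ} (hm : 1 < m)
    (hunit : ∀ x ∈ closure (Omega n A a b), IsUnit (matD N d x))
    {mu : (Fin n → ℝ) × ℝ → ℝ} (hmu : Continuous mu) {K : (Fin n → ℝ) × ℝ → ℝ → ℝ → ℝ}
    (hK : ContDiffOn ℝ 2 (fun p : ((Fin n → ℝ) × ℝ) × ℝ × ℝ => K p.1 p.2.1 p.2.2)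
      (closure (Omega n A a b) ×ˢ Icc (-d) d ×ˢ Icc (-d) d))
    {P W₁ W₂ : (Fin n → ℕ) → ℝ → Fin N → ℝ} (hH₁ : MemH1h A a b m W₁) (hH₂ : MemH1h A a b m W₂)
    (hS₁ : SolvesSystem A a b d m mu K W₁) (hS₂ : SolvesSystem A a b d m mu K W₂)
    (hP₁ : HasBoundaryValues a b m P W₁) (hP₂ : HasBoundaryValues a b m P W₂)
    {J : Fin n → ℕ} (hJ : OnGrid m J) {y : ℝ} (hy : y ∈ Icc a b) : W₁ J y = W₂ J y := by
  have hbdry : ∀ J y, OnBoundary a b m J y → W₁ J y = W₂ J y := fun J y h =>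
    (hP₁ J y h).trans (hP₂ J y h).symm
  set I := interiorIndices n N m with hI
  -- A common bound `R` for both solutions.
  have hbd : ∀ p : (Fin n → ℕ) × Fin N, ∃ R : ℝ, p ∈ I → ∀ y ∈ Icc a b,
      |W₁ p.1 y p.2| ≤ R ∧ |W₂ p.1 y p.2| ≤ R := by
    rintro ⟨J, s⟩
    by_cases hp : (J, s) ∈ I
    · have hJ := mem_interiorIndices.1 hp
      obtain ⟨R₁, h₁⟩ := (hH₁ J hJ s).1.1.exists_bound
      obtain ⟨R₂, h₂⟩ := (hH₂ J hJ s).1.1.exists_bound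
      rw [uIcc_of_le hab.le] at h₁ h₂
      exact ⟨max R₁ R₂, fun _ y hy => ⟨(h₁ y hy).trans (le_max_left _ _),
        (h₂ y hy).trans (le_max_right _ _)⟩⟩
    · exact ⟨0, fun h => absurd h hp⟩
  choose R' hR' using hbd
  set R := ∑ p ∈ I, |R' p| with hR
  have hR0 : 0 ≤ R := Finset.sum_nonneg fun _ _ => abs_nonneg _
  have hnorm : ∀ J, Interior m J → ∀ y ∈ Icc a b, ‖W₁ J y‖ ≤ R ∧ ‖W₂ J y‖ ≤ R := by
    intro J hJ y hy
    have h : ∀ s, R' (J, s) ≤ R := fun s => (le_abs_self _).trans (Finset.single_le_sum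
      (f := fun p => |R' p|) (fun _ _ => abs_nonneg _) (mem_interiorIndices.2 hJ))
    have h' := fun s => hR' (J, s) (mem_interiorIndices.2 hJ) y hy
    exact ⟨(pi_norm_le_iff_of_nonneg hR0).2 fun s => (h' s).1.trans (h s),
      (pi_norm_le_iff_of_nonneg hR0).2 fun s => (h' s).2.trans (h s)⟩
  obtain ⟨cF, hcF, hF⟩ := exists_lipschitz_nonlin (N := N) hA hd ha hab hR0 hmu hK
  obtain ⟨cD, hcD, hD⟩ := exists_bound_inv_matD N d (by linarith : 0 < a) hunit
  obtain ⟨B, hB, hPsi⟩ := exists_bound_Psi N d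
  set cA := ((A + d) * B + (1 + (A + d) * (A + d)) * B) * B * (2 * d) with hcA
  have hcA0 : 0 ≤ cA := by positivity
  have hh := step_pos hA hm
  set v : (Fin n → ℕ) × Fin N → ℝ → ℝ := fun p y => W₁ p.1 y p.2 - W₂ p.1 y p.2 with hv
  set φ : ℝ → ℝ := fun y => ∑ p ∈ I, |v p y| with hφ
  have hφ0 : ∀ y, 0 ≤ φ y := fun y => Finset.sum_nonneg fun _ _ => abs_nonneg _
  -- The difference of the solutions vanishes on the lateral boundary.
  have hvφ : ∀ J, OnGrid m J → ∀ y ∈ Ioo a b, ∀ s, |W₁ J y s - W₂ J y s| ≤ φ y := by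
    intro J hJ y hy s
    by_cases hin : Interior m J
    · exact Finset.single_le_sum (f := fun p => |v p y|) (fun _ _ => abs_nonneg _)
        (mem_interiorIndices.2 hin : (J, s) ∈ I)
    · rw [hbdry J y (onBoundary_of_not_interior hJ hin hy), sub_self, abs_zero]
      exact hφ0 y
  have hfd : ∀ J, Interior m J → ∀ y ∈ Ioo a b, ∀ i s,
      |(fdiff A m W₁ i J y - fdiff A m W₂ i J y) s| ≤ φ y / step A m := by
    intro J hJ y hy i s
    have h1 := hvφ _ (onGrid_update_of_interior hJ i (r := J i + 1) (hJ i).2) y hy s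
    have h2 := hvφ _ (onGrid_update_of_interior hJ i (r := J i - 1)
      (by have := (hJ i).2; omega)) y hy s
    simp only [Pi.sub_apply, fdiff]
    rw [← sub_div, sub_sub_sub_comm, abs_div, abs_of_pos (by positivity : 0 < 2 * step A m),
      div_le_div_iff₀ (by positivity) hh]
    have h3 := (abs_sub _ _).trans (add_le_add h1 h2)
    nlinarith [mul_le_mul_of_nonneg_right h3 hh.le]
  set C := N * (cD * (n * (N * (cA * (1 / step A m))) + cF)) with hC
  have hmain : ∀ p ∈ I, ∀ y ∈ Icc a b, v p y = 0 := by
    refine eq_zero_of_ae_abs_deriv_le (C := C) ?_ ?_ hab.le ?_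
    · rintro ⟨J, s⟩ hp
      have hJ := mem_interiorIndices.1 hp
      exact (hH₁ J hJ s).1.1.sub (hH₂ J hJ s).1.1
    · rintro ⟨J, s⟩ hp
      have hJ := mem_interiorIndices.1 hp
      simp only [hv]
      rw [hbdry J a ⟨hJ.onGrid, Or.inl rfl⟩, sub_self]
    · rintro ⟨J, s⟩ hp
      have hJ := mem_interiorIndices.1 hp
      have hae : ∀ W : (Fin n → ℕ) → ℝ → Fin N → ℝ, MemH1h A a b m W →
          ∀ᵐ y ∂(volume.restrict (Ioo a b)), DifferentiableAt ℝ (fun t => W J t s) y := by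
        intro W hW
        rw [ae_restrict_iff' measurableSet_Ioo]
        filter_upwards [(hW J hJ s).1.1.ae_differentiableAt] with y hy' hy
        exact hy' (by rw [uIcc_of_le hab.le]; exact Ioo_subset_Icc_self hy)
      filter_upwards [hae W₁ hH₁, hae W₂ hH₂, hS₁ J hJ, hS₂ J hJ,
        ae_restrict_mem measurableSet_Ioo] with y hd₁ hd₂ he₁ he₂ hy
      have hx := subset_closure (pt_mem_Omega hA hm hJ hy)
      set x := pt A m J y with hxdef
      have hxa : 1 ≤ x.2 := ha.trans hy.1.le
      have hdet := (Matrix.isUnit_iff_isUnit_det _).1 (hunit x hx)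
      set g : Fin N → ℝ := (∑ i, matA N d i x *ᵥ (fdiff A m W₁ i J y - fdiff A m W₂ i J y))
        + (nonlin d mu K (W₁ J y) x - nonlin d mu K (W₂ J y) x) with hg
      -- Solve the difference of the two systems for the derivative.
      have hDv : matD N d x *ᵥ (dy W₁ J y - dy W₂ J y) = -g := by
        rw [eq_neg_iff_add_eq_zero, hg]
        simp only [Matrix.mulVec_sub, Finset.sum_sub_distrib]
        linear_combination he₁ - he₂
      have hsolve : dy W₁ J y - dy W₂ J y = (matD N d x)⁻¹ *ᵥ (-g) := by
        rw [← hDv, Matrix.mulVec_mulVec, Matrix.nonsing_inv_mul _ hdet, Matrix.one_mulVec]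
      have hgb : ∀ k, |(-g) k| ≤ (n * (N * (cA * (1 / step A m))) + cF) * φ y := by
        intro k
        rw [Pi.neg_apply, abs_neg, hg, Pi.add_apply, Finset.sum_apply, add_mul]
        refine (abs_add_le _ _).trans (add_le_add ?_ ?_)
        · refine (Finset.abs_sum_le_sum_abs _ _).trans ((Finset.sum_le_card_nsmul _ _
            (N * (cA * (φ y / step A m))) fun i _ => ?_).trans (le_of_eq ?_))
          · exact abs_mulVec_le hcA0
              (abs_matA_le hA.le hd.le hB hPsi hxa (abs_fst_le_of_mem_closure hx) i)
              (hfd J hJ y hy i) k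
          · simp
            ring
        · have hyI := Ioo_subset_Icc_self hy
          refine (hF x hx _ _ (hnorm J hJ y hyI).1 (hnorm J hJ y hyI).2 k).trans ?_
          exact mul_le_mul_of_nonneg_left
            ((pi_norm_le_iff_of_nonneg (hφ0 y)).2 (hvφ J hJ.onGrid y hy)) hcF
      have hder : deriv (v (J, s)) y = (dy W₁ J y - dy W₂ J y) s := deriv_fun_sub hd₁ hd₂
      rw [hder, hsolve]
      refine (abs_mulVec_le hcD (hD x hx) hgb s).trans (le_of_eq ?_)
      rw [hC]
      ring
  by_cases hin : Interior m J
  · funext s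
    exact sub_eq_zero.1 (hmain (J, s) (mem_interiorIndices.2 hin) y hy)
  · rcases eq_or_ne y a with rfl | hya
    · exact hbdry J _ ⟨hJ, Or.inl rfl⟩
    rcases eq_or_ne y b with rfl | hyb
    · exact hbdry J _ ⟨hJ, Or.inr (Or.inl rfl)⟩
    · exact hbdry J y (onBoundary_of_not_interior hJ hin
        ⟨lt_of_le_of_ne hy.1 hya.symm, lt_of_le_of_ne hy.2 hyb⟩)

/-- The reconstruction formula determines the coefficient from the values of `W` on the grid. -/
lemma ae_eq_of_reconstructs {n N : ℕ} [NeZero n] {A a b d : ℝ} {m : ℕ}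
    {mu : (Fin n → ℝ) × ℝ → ℝ} {K : (Fin n → ℝ) × ℝ → ℝ → ℝ → ℝ}
    {W₁ W₂ : (Fin n → ℕ) → ℝ → Fin N → ℝ} {c₁ c₂ : (Fin n → ℕ) → ℝ → ℝ}
    (h₁ : Reconstructs A a b d m mu K W₁ c₁) (h₂ : Reconstructs A a b d m mu K W₂ c₂)
    (hW : ∀ J, OnGrid m J → ∀ y ∈ Icc a b, W₁ J y = W₂ J y)
    {J : Fin n → ℕ} (hJ : Interior m J) : c₁ J =ᵐ[volume.restrict (Ioo a b)] c₂ J := by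
  filter_upwards [h₁ J hJ, h₂ J hJ, ae_restrict_mem measurableSet_Ioo] with y e₁ e₂ hy
  have hyI := Ioo_subset_Icc_self hy
  have hfd : ∀ i, fdiff A m W₁ i J y = fdiff A m W₂ i J y := by
    intro i
    funext s
    simp only [fdiff]
    rw [hW _ (onGrid_update_of_interior hJ i (r := J i + 1) (hJ i).2) y hyI,
      hW _ (onGrid_update_of_interior hJ i (r := J i - 1) (by have := (hJ i).2; omega)) y hyI]
  have hdy : dy W₁ J y = dy W₂ J y := by
    funext s
    refine Filter.EventuallyEq.deriv_eq ?_
    filter_upwards [Icc_mem_nhds hy.1 hy.2] with t ht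
    rw [hW J hJ.onGrid t ht]
  rw [e₁, e₂]
  simp only [transport, hfd, hdy, hW J hJ.onGrid y hyI]

end RTE

end

theorem theorem4p3 (n : ℕ) [NeZero n] (N : ℕ) (A d : ℝ) (hA : 0 < A) (hd : 0 < d) :
    (∃ a₀ : ℝ, RTE.IsThreshold n N A d a₀) ∧
    ∀ a₀ : ℝ, RTE.IsThreshold n N A d a₀ →
    ∀ a b : ℝ, a₀ ≤ a → a < b →
    ∀ m : ℕ, 1 < m →
    ∀ mu : (Fin n → ℝ) × ℝ → ℝ, ContDiff ℝ 2 mu → (∀ x, 0 ≤ mu x) →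
      (∀ x, x ∉ RTE.Omega n A a b → mu x = 0) →
    ∀ K : (Fin n → ℝ) × ℝ → ℝ → ℝ → ℝ,
      ContDiffOn ℝ 2 (fun p : ((Fin n → ℝ) × ℝ) × ℝ × ℝ => K p.1 p.2.1 p.2.2)
        (closure (RTE.Omega n A a b) ×ˢ Icc (-d) d ×ˢ Icc (-d) d) →
      (∀ x ∈ closure (RTE.Omega n A a b), ∀ α ∈ Icc (-d) d, ∀ β ∈ Icc (-d) d, 0 ≤ K x α β) →
    ∀ P W₁ W₂ : (Fin n → ℕ) → ℝ → Fin N → ℝ, ∀ c₁ c₂ : (Fin n → ℕ) → ℝ → ℝ,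
      RTE.IsSolution A a b d m mu K P W₁ c₁ →
      RTE.IsSolution A a b d m mu K P W₂ c₂ →
      (∀ J, RTE.OnGrid m J → ∀ y ∈ Icc a b, W₁ J y = W₂ J y) ∧
      ∀ J, RTE.Interior m J → c₁ J =ᵐ[volume.restrict (Ioo a b)] c₂ J := by
  refine ⟨RTE.exists_isThreshold n N hA hd, ?_⟩
  intro a₀ ha₀ a b ha hab m hm mu hmu _ _ K hK _ P W₁ W₂ c₁ c₂ h₁ h₂
  have hW : ∀ J, RTE.OnGrid m J → ∀ y ∈ Icc a b, W₁ J y = W₂ J y := fun J hJ y hy =>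
    RTE.eq_of_solvesSystem hA hd (ha₀.1.le.trans ha) hab hm (ha₀.2 a b ha hab) hmu.continuous hK
      h₁.memH1 h₂.memH1 h₁.system h₂.system h₁.boundary h₂.boundary hJ hy
  exact ⟨hW, fun J hJ => RTE.ae_eq_of_reconstructs h₁.reconstruction h₂.reconstruction hW hJ⟩
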